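/- Let $n\ge 1$, let $\sigma_0=I,\sigma_1=X,\sigma_2=Y,\sigma_3=Z$ be the Pauli matrices, let $\sigma_{(i_1,\dots,i_n)}=\sigma_{i_1}\otimes\cdots\otimes\sigma_{i_n}$, and let $\rho_{\rm in}\in\mathbb C^{2^n\times 2^n}$ be an $n$-qubit density matrix (positive semidefinite, trace $1$). Put $$\alpha(\rho_{\rm in})=\mathrm{Tr}[\sigma_{(1,0,\dots,0)}\rho_{\rm in}]^2+\mathrm{Tr}[\sigma_{(3,0,\dots,0)}\rho_{\rm in}]^2 .$$ Circuits consist of rotations $e^{-i\theta\sigma_2}$, each with its own parameter $\theta$, and of CNOT gates $|0\rangle\langle0|\otimes\sigma_0+|1\rangle\langle1|\otimes\sigma_1$ (control $\otimes$ target). For a circuit with operator $V(\boldsymbol\theta)$ let $$f(\boldsymbol\theta)=\tfrac12+\tfrac12\,\mathrm{Tr}\big[\sigma_{(3,0,\dots,0)}\,V(\boldsymbol\theta)\,\rho_{\rm in}\,V(\boldsymbol\theta)^\dagger\big],$$ and let $\mathbb E_{\boldsymbol\theta}$ be the expectation over independent parameters, each uniform on $[0,2\pi]$. The functions $f$ below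 are differentiable and the expectations below are finite. (TT) Let $n=2^m$ with $m\ge 0$. The tree-tensor circuit $V_{\rm TT}$ first rotates every qubit; then, for $\ell=1,\dots,m$ in this order, it applies for every $j\in\{0,\dots,n2^{-\ell}-1\}$ a CNOT with target qubit $j2^{\ell}+1$ and control qubit $j2^{\ell}+2^{\ell-1}+1$, and then rotates each of these target qubits. It has $2n-1$ parameters, and its objective function $f_{\rm TT}$ satisfies $$\frac{1+\log_2 n}{2n}\,\alpha(\rho_{\rm in})\;\le\;\mathbb E_{\boldsymbol\theta}\|\nabla_{\boldsymbol\theta}f_{\rm TT}\|^2\;\le\;2n-1 .$$ (SC) Let $n_c$ be an integer with $1\le n_c\le n-1$ (or $n_c=0$ if $n=1$). The step-controlled circuit $V_{\rm SC}$ first rotates every qubit; then, for $c=n,n-1,\dots,2$ in this order, it applies a CNOT with control qubit $c$ and target qubit $t(c)$ and then rotates qubit $t(c)$, where $t(c)=c-1$ if $c>n_c+1$ and $t(c)=1$ if $c\le n_c+1$. Thus exactly $n_c$ CNOTs act on the first qubit. It has $2n-1$ parameters, and its objective function $f_{\rm SC}$ satisfies $$\frac{1+n_c}{2^{1+n_c}}\,\alpha(\rho_{\rm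 in})\;\le\;\mathbb E_{\boldsymbol\theta}\|\nabla_{\boldsymbol\theta}f_{\rm SC}\|^2\;\le\;2n-1 .$$ -/

import Mathlib

open MeasureTheory
open scoped ComplexOrder

noncomputable section

namespace QNN

/-- Operators on the `n`-qubit space, as matrices over the computational basis of `n`-bit strings
(`2 ^ n` basis vectors).  Qubits are numbered `0, …, n - 1`; the first qubit is qubit `0`. -/
abbrev QMatrix (n : ℕ) : Type := Matrix (Fin n → Fin 2) (Fin n → Fin 2) ℂ

/-- The tensor product `A 0 ⊗ A 1 ⊗ ⋯ ⊗ A (n - 1)` of single-qubit operators. -/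
def tensor {n : ℕ} (A : Fin n → Matrix (Fin 2) (Fin 2) ℂ) : QMatrix n :=
  Matrix.of fun x y => ∏ k, A k (x k) (y k)

/-- The Pauli matrices `σ₀ = I, σ₁ = X, σ₂ = Y, σ₃ = Z`. -/
def pauli : Fin 4 → Matrix (Fin 2) (Fin 2) ℂ :=
  ![1, !![0, 1; 1, 0], !![0, -Complex.I; Complex.I, 0], !![1, 0; 0, -1]]

/-- The Pauli string `σ_{i₁} ⊗ ⋯ ⊗ σ_{iₙ}`. -/
def pauliString {n : ℕ} (i : Fin n → Fin 4) : QMatrix n :=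
  tensor fun k => pauli (i k)

/-- The Pauli string with `σ_i` on the first qubit and `σ₀` on all others. -/
def firstPauli {n : ℕ} [NeZero n] (i : Fin 4) : QMatrix n :=
  pauliString (Pi.single 0 i)

/-- The rotation `e^{-iθσ₂}` (matrix exponential). -/
def rotY (θ : ℝ) : Matrix (Fin 2) (Fin 2) ℂ :=
  NormedSpace.exp ((-(Complex.I * (θ : ℂ))) • pauli 2)

/-- The single-qubit operator `A` acting on qubit `q`, tensored with the identity elsewhere. -/
def onQubit {n : ℕ} (q : Fin n) (A : Matrix (Fin 2) (Fin 2) ℂ) : QMatrix n :=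
  tensor (Function.update (fun _ => 1) q A)

/-- CNOT with the given control and target:
`|0⟩⟨0|` on the control, plus `|1⟩⟨1|` on the control tensored with `σ₁` on the target. -/
def cnotMatrix {n : ℕ} (control target : Fin n) : QMatrix n :=
  onQubit control !![1, 0; 0, 0] + onQubit control !![0, 0; 0, 1] * onQubit target (pauli 1)

/-- The gates of a parameterized circuit on `n` qubits whose parameters are labelled by `P`. -/
inductive Gate (n : ℕ) (P : Type) : Type
  /-- the rotation `e^{-iθσ₂}` on the qubit `q`, where `θ` is the value of the parameter `p` -/
  | ry (p : P) (q : Fin n) : Gate n P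
  /-- CNOT -/
  | cnot (control target : Fin n) (h : control ≠ target) : Gate n P

/-- The operator of a gate at the parameter values `θ`. -/
def Gate.toMatrix {n : ℕ} {P : Type} (θ : P → ℝ) : Gate n P → QMatrix n
  | .ry p q => onQubit q (rotY (θ p))
  | .cnot c t _ => cnotMatrix c t

/-- The operator `V(θ)` of a circuit; the head of the list is the gate that is applied first. -/
def circuitMatrix {n : ℕ} {P : Type} (θ : P → ℝ) : List (Gate n P) → QMatrix n
  | [] => 1
  | g :: C => circuitMatrix θ C * g.toMatrix θ

/-! ### The tree-tensor circuit -/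

/-- Parameters of the tree-tensor circuit on `2 ^ m` qubits: the layers are `ℓ = 0, …, m`,
and layer `ℓ` has `2 ^ m / 2 ^ ℓ` parameters. -/
abbrev TTParam (m : ℕ) : Type := Σ ℓ : Fin (m + 1), Fin (2 ^ (m - (ℓ : ℕ)))

theorem tt_rot_lt {n m : ℕ} (hn : n = 2 ^ m) (ℓ : Fin (m + 1)) (j : Fin (2 ^ (m - (ℓ : ℕ)))) :
    (j : ℕ) * 2 ^ (ℓ : ℕ) < n := by
  have h : 2 ^ (m - (ℓ : ℕ)) * 2 ^ (ℓ : ℕ) = 2 ^ m := by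
    rw [← pow_add, Nat.sub_add_cancel (by omega)]
  rw [hn, ← h]
  exact Nat.mul_lt_mul_of_pos_right j.2 (by positivity)

theorem tt_control_lt {n m : ℕ} (hn : n = 2 ^ m) (ℓ : Fin m) (j : Fin (2 ^ (m - ((ℓ : ℕ) + 1)))) :
    (j : ℕ) * 2 ^ ((ℓ : ℕ) + 1) + 2 ^ (ℓ : ℕ) < n := by
  have h : 2 ^ (m - ((ℓ : ℕ) + 1)) * 2 ^ ((ℓ : ℕ) + 1) = 2 ^ m := by
    rw [← pow_add, Nat.sub_add_cancel (by omega)]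
  have h1 : ((j : ℕ) + 1) * 2 ^ ((ℓ : ℕ) + 1) ≤ 2 ^ (m - ((ℓ : ℕ) + 1)) * 2 ^ ((ℓ : ℕ) + 1) :=
    Nat.mul_le_mul_right _ j.2
  have h2 : 2 ^ (ℓ : ℕ) < 2 ^ ((ℓ : ℕ) + 1) := Nat.pow_lt_pow_right (by norm_num) (by omega)
  rw [add_mul, one_mul] at h1
  omega

/-- Rotation layer `ℓ` of the tree: parameter `j` of the layer rotates qubit `j * 2 ^ ℓ`. -/
def ttRotLayer {n m : ℕ} (hn : n = 2 ^ m) (ℓ : Fin (m + 1)) : List (Gate n (TTParam m)) :=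
  List.ofFn fun j : Fin (2 ^ (m - (ℓ : ℕ))) =>
    Gate.ry ⟨ℓ, j⟩ ⟨(j : ℕ) * 2 ^ (ℓ : ℕ), tt_rot_lt hn ℓ j⟩

/-- CNOT layer that follows rotation layer `ℓ`: the target is qubit `j * 2 ^ (ℓ + 1)` and the
control is qubit `j * 2 ^ (ℓ + 1) + 2 ^ ℓ`, for `j < n / 2 ^ (ℓ + 1)`. -/
def ttCnotLayer {n m : ℕ} (hn : n = 2 ^ m) (ℓ : Fin m) : List (Gate n (TTParam m)) :=
  List.ofFn fun j : Fin (2 ^ (m - ((ℓ : ℕ) + 1))) =>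
    Gate.cnot
      ⟨(j : ℕ) * 2 ^ ((ℓ : ℕ) + 1) + 2 ^ (ℓ : ℕ), tt_control_lt hn ℓ j⟩
      ⟨(j : ℕ) * 2 ^ ((ℓ : ℕ) + 1), lt_of_le_of_lt (Nat.le_add_right _ _) (tt_control_lt hn ℓ j)⟩
      (by
        intro h
        have h1 := congrArg Fin.val h
        have h2 : 0 < 2 ^ (ℓ : ℕ) := by positivity
        simp only at h1
        omega)

/-- The tree-tensor circuit on `n = 2 ^ m` qubits: a rotation layer on all qubits, followed by
`m` times a CNOT layer and a rotation layer on the targets of these CNOTs. -/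
def ttCircuit {n m : ℕ} (hn : n = 2 ^ m) : List (Gate n (TTParam m)) :=
  ttRotLayer hn 0 ++
    (List.finRange m).flatMap fun ℓ => ttCnotLayer hn ℓ ++ ttRotLayer hn ℓ.succ

/-! ### The step-controlled circuit -/

/-- Parameters of the step-controlled circuit: `n` for the rotations of the first layer, and one
for the rotation that follows each of the `n - 1` CNOTs. -/
abbrev SCParam (n : ℕ) : Type := Fin n ⊕ Fin (n - 1)

/-- The qubit that controls the CNOT number `i`: these are `n - 1, n - 2, …, 1` in this order. -/
def scControl (n : ℕ) (i : Fin (n - 1)) : Fin n := ⟨n - 1 - (i : ℕ), by omega⟩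

/-- The target of the CNOT number `i`, with control `c`: the adjacent qubit `c - 1` while
`c > nc`, and the first qubit for the last `nc` CNOTs, whose controls are `nc, …, 1`. -/
def scTarget (n nc : ℕ) (i : Fin (n - 1)) : Fin n :=
  ⟨if nc < n - 1 - (i : ℕ) then n - 1 - (i : ℕ) - 1 else 0, by split_ifs <;> omega⟩

theorem scControl_ne_scTarget (n nc : ℕ) (i : Fin (n - 1)) :
    scControl n i ≠ scTarget n nc i := by
  intro h
  have h1 := congrArg Fin.val h
  simp only [scControl, scTarget] at h1
  split_ifs at h1 <;> omega

/-- The step-controlled circuit: a rotation layer on all qubits, followed by `n - 1` CNOTs, each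
of them followed by a rotation of its target. -/
def scCircuit (n nc : ℕ) : List (Gate n (SCParam n)) :=
  (List.ofFn fun q : Fin n => Gate.ry (Sum.inl q) q) ++
    (List.finRange (n - 1)).flatMap fun i =>
      [Gate.cnot (scControl n i) (scTarget n nc i) (scControl_ne_scTarget n nc i),
        Gate.ry (Sum.inr i) (scTarget n nc i)]

/-! ### Objective function, expectation, and the constant of the input state -/

/-- A quantum state (density matrix). -/
def IsState {n : ℕ} (ρ : QMatrix n) : Prop := ρ.PosSemidef ∧ ρ.trace = 1

/-- The objective function `f(θ) = 1/2 + 1/2 Tr[(σ₃ ⊗ I ⊗ ⋯ ⊗ I) V(θ) ρ V(θ)†]`.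
The trace is real for Hermitian `ρ`. -/
def objective {n : ℕ} [NeZero n] {P : Type} (C : List (Gate n P)) (ρ : QMatrix n)
    (θ : EuclideanSpace ℝ P) : ℝ :=
  1 / 2 + 1 / 2 *
    (firstPauli 3 * circuitMatrix θ C * ρ * (circuitMatrix θ C).conjTranspose).trace.re

/-- The law of independent parameters, each uniform on `[0, 2π]`. -/
def uniformParams (P : Type) [Fintype P] : Measure (P → ℝ) :=
  Measure.pi fun _ => ProbabilityTheory.cond volume (Set.Icc (0 : ℝ) (2 * Real.pi))

/-- The squared Euclidean norm of the gradient of `f` at `θ`. -/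
def sqGradNorm {P : Type} [Fintype P] (f : EuclideanSpace ℝ P → ℝ) (θ : P → ℝ) : ℝ :=
  ‖gradient f (WithLp.toLp 2 θ)‖ ^ 2

/-- `α(ρ) = Tr[σ_(1,0,…,0) ρ]² + Tr[σ_(3,0,…,0) ρ]²`; both traces are real for Hermitian `ρ`. -/
def alpha {n : ℕ} [NeZero n] (ρ : QMatrix n) : ℝ :=
  (firstPauli 1 * ρ).trace.re ^ 2 + (firstPauli 3 * ρ).trace.re ^ 2

end QNN

end

noncomputable section

namespace QNN

/-! ### Single-qubit operators -/

section Operators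

open Matrix

variable {n : ℕ}

/-! In the Heisenberg picture the last gate of a circuit conjugates the observable. Let a and b be
the second moments, over the parameters, of the means of X and Z on the first qubit. A rotation of
that qubit by a fresh angle turns the pair of means by the doubled angle, so averaging replaces (a,
b) by ((a + b)/2, (a + b)/2). A CNOT targeting the qubit commutes with X and keeps a; it turns Z
into a two-qubit string, for which only the bound 0 is kept. All other gates commute with both
observables, since no CNOT is controlled by the first qubit. With an initial rotation and then k
CNOTs onto the first qubit, each followed by a rotation of it, both moments are at least α/2^(k+1).

The gradient obeys the same recursion. A mean is a trigonometric polynomial of degree one in twice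
each parameter (`exists_mean_add_single_eq`), so a partial derivative of f is a central difference
of the mean of Z (`gradient_objective_apply`). At the gate carrying the parameter this difference is
a further quarter turn of the doubled angle, and it commutes with what later gates do. Hence each of
the k + 1 rotations of the first qubit contributes at least α/2^(k+1) (`secondMomentGe_centralDiff`,
summed in `integral_sqGradNorm_ge`); k is log₂ n for the tree and n_c for the step-controlled
circuit. For the upper bound, each of the 2n - 1 differences has absolute value at most 1. -/

theorem tensor_mul (A B : Fin n → Matrix (Fin 2) (Fin 2) ℂ) :
    tensor A * tensor B = tensor fun k => A k * B k := by
  ext x z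
  simp only [tensor, Matrix.mul_apply, Matrix.of_apply, Finset.prod_univ_sum,
    Fintype.piFinset_univ, Finset.prod_mul_distrib]

theorem tensor_conjTranspose (A : Fin n → Matrix (Fin 2) (Fin 2) ℂ) :
    (tensor A)ᴴ = tensor fun k => (A k)ᴴ := by
  ext x y
  simp [tensor, Matrix.conjTranspose_apply]

theorem onQubit_apply (q : Fin n) (A : Matrix (Fin 2) (Fin 2) ℂ) (x y : Fin n → Fin 2) :
    onQubit q A x y =
      A (x q) (y q) * ∏ k ∈ Finset.univ.erase q, (1 : Matrix (Fin 2) (Fin 2) ℂ) (x k) (y k) := by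
  simp only [onQubit, tensor, Matrix.of_apply]
  rw [← Finset.mul_prod_erase _ _ (Finset.mem_univ q), Function.update_self]
  congr 1
  refine Finset.prod_congr rfl fun k hk => ?_
  rw [Function.update_of_ne (Finset.ne_of_mem_erase hk)]

theorem onQubit_one (q : Fin n) : onQubit q 1 = 1 := by
  ext x y
  simp only [onQubit, Function.update_eq_self_iff.mpr rfl, tensor, Matrix.of_apply,
    Matrix.one_apply]
  simp [Finset.prod_ite_zero, funext_iff]

theorem onQubit_mul (q : Fin n) (A B : Matrix (Fin 2) (Fin 2) ℂ) :
    onQubit q A * onQubit q B = onQubit q (A * B) := by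
  rw [onQubit, onQubit, onQubit, tensor_mul]
  congr 1
  ext1 k
  by_cases h : k = q
  · subst h; simp
  · simp [h]

theorem onQubit_add (q : Fin n) (A B : Matrix (Fin 2) (Fin 2) ℂ) :
    onQubit q (A + B) = onQubit q A + onQubit q B := by
  ext x y
  simp only [onQubit_apply, Matrix.add_apply, add_mul]

theorem onQubit_smul (q : Fin n) (c : ℂ) (A : Matrix (Fin 2) (Fin 2) ℂ) :
    onQubit q (c • A) = c • onQubit q A := by
  ext x y
  simp only [onQubit_apply, Matrix.smul_apply, smul_eq_mul, mul_assoc]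

theorem onQubit_conjTranspose (q : Fin n) (A : Matrix (Fin 2) (Fin 2) ℂ) :
    (onQubit q A)ᴴ = onQubit q Aᴴ := by
  rw [onQubit, onQubit, tensor_conjTranspose]
  congr 1
  ext1 k
  by_cases h : k = q
  · subst h; simp
  · simp [h]

theorem onQubit_commute {q r : Fin n} (h : q ≠ r) (A B : Matrix (Fin 2) (Fin 2) ℂ) :
    Commute (onQubit q A) (onQubit r B) := by
  rw [Commute, SemiconjBy, onQubit, onQubit, tensor_mul, tensor_mul]
  congr 1
  ext1 k
  by_cases hq : k = q
  · subst hq; simp [h]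
  · by_cases hr : k = r
    · subst hr; simp [hq]
    · simp [hq, hr]

theorem firstPauli_eq [NeZero n] (i : Fin 4) : firstPauli (n := n) i = onQubit 0 (pauli i) := by
  rw [firstPauli, pauliString, onQubit]
  congr 1
  ext1 k
  by_cases h : k = 0
  · subst h; simp
  · simp [h, pauli]

-- With J = -iσ₂ one has J² = -1, so a + bi ↦ a + bJ is a real algebra homomorphism. It is
-- continuous, hence carries the complex exponential of iθ to that of θJ.
open scoped Matrix.Norms.Operator in
theorem rotY_eq (θ : ℝ) : rotY θ =
    !![(Real.cos θ : ℂ), -(Real.sin θ : ℂ); (Real.sin θ : ℂ), (Real.cos θ : ℂ)] := by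
  have hJ : (!![0, -1; 1, 0] : Matrix (Fin 2) (Fin 2) ℂ) * !![0, -1; 1, 0] = -1 := by
    ext i j; fin_cases i <;> fin_cases j <;> simp
  let F : ℂ →ₐ[ℝ] Matrix (Fin 2) (Fin 2) ℂ := Complex.lift ⟨!![0, -1; 1, 0], hJ⟩
  have hF : ∀ z : ℂ, F z = !![(z.re : ℂ), -(z.im : ℂ); (z.im : ℂ), (z.re : ℂ)] := by
    intro z
    ext i j
    fin_cases i <;> fin_cases j <;>
      simp [F, Complex.liftAux_apply, Matrix.algebraMap_matrix_apply]
  have hc : Continuous F := F.toLinearMap.continuous_of_finiteDimensional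
  have h := NormedSpace.map_exp F hc (θ * Complex.I)
  rw [← Complex.exp_eq_exp_ℂ, hF, hF] at h
  simp only [Complex.exp_ofReal_mul_I_re, Complex.exp_ofReal_mul_I_im] at h
  rw [h, rotY]
  congr 1
  ext i j
  fin_cases i <;> fin_cases j <;> simp [pauli, mul_right_comm]

theorem rotY_conjTranspose_mul_self (θ : ℝ) : (rotY θ)ᴴ * rotY θ = 1 := by
  have h : (Real.cos θ : ℂ) ^ 2 + (Real.sin θ : ℂ) ^ 2 = 1 := by
    exact_mod_cast Real.cos_sq_add_sin_sq θ
  rw [rotY_eq]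
  ext i j
  fin_cases i <;> fin_cases j <;>
    simp [Matrix.mul_apply, Matrix.conjTranspose_apply, Fin.sum_univ_two, -Complex.ofReal_cos,
      -Complex.ofReal_sin] <;> first | linear_combination h | ring

theorem rotY_conj_pauli_one (θ : ℝ) : (rotY θ)ᴴ * pauli 1 * rotY θ =
    (Real.cos (2 * θ) : ℂ) • pauli 1 + (Real.sin (2 * θ) : ℂ) • pauli 3 := by
  rw [rotY_eq, Real.cos_two_mul', Real.sin_two_mul]
  ext i j
  fin_cases i <;> fin_cases j <;>
    simp [pauli, Matrix.mul_apply, Matrix.conjTranspose_apply, Fin.sum_univ_two,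
      -Complex.ofReal_cos, -Complex.ofReal_sin] <;> ring

theorem rotY_conj_pauli_three (θ : ℝ) : (rotY θ)ᴴ * pauli 3 * rotY θ =
    (Real.cos (2 * θ) : ℂ) • pauli 3 + (-Real.sin (2 * θ) : ℂ) • pauli 1 := by
  rw [rotY_eq, Real.cos_two_mul', Real.sin_two_mul]
  ext i j
  fin_cases i <;> fin_cases j <;>
    simp [pauli, Matrix.mul_apply, Matrix.conjTranspose_apply, Fin.sum_univ_two,
      -Complex.ofReal_cos, -Complex.ofReal_sin] <;> ring

theorem rotY_eq_add (θ : ℝ) : rotY θ =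
    (Real.cos θ : ℂ) • (1 : Matrix (Fin 2) (Fin 2) ℂ) + (Real.sin θ : ℂ) • !![0, -1; 1, 0] := by
  rw [rotY_eq]
  ext i j
  fin_cases i <;> fin_cases j <;> simp

end Operators

/-! ### Gates -/

section Gates

open Matrix

variable {n : ℕ} {P : Type}

theorem cnotMatrix_conjTranspose {c t : Fin n} (h : c ≠ t) :
    (cnotMatrix c t)ᴴ = cnotMatrix c t := by
  have h0 : (!![1, 0; 0, 0] : Matrix (Fin 2) (Fin 2) ℂ)ᴴ = !![1, 0; 0, 0] := by
    ext i j; fin_cases i <;> fin_cases j <;> simp [Matrix.conjTranspose_apply]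
  have h1 : (!![0, 0; 0, 1] : Matrix (Fin 2) (Fin 2) ℂ)ᴴ = !![0, 0; 0, 1] := by
    ext i j; fin_cases i <;> fin_cases j <;> simp [Matrix.conjTranspose_apply]
  have hX : (pauli 1)ᴴ = pauli 1 := by
    ext i j; fin_cases i <;> fin_cases j <;> simp [pauli, Matrix.conjTranspose_apply]
  rw [cnotMatrix, Matrix.conjTranspose_add, Matrix.conjTranspose_mul, onQubit_conjTranspose,
    onQubit_conjTranspose, onQubit_conjTranspose, h0, h1, hX, (onQubit_commute h _ _).eq]

/-- The projections on the control are orthogonal and sum to 1, so the cross terms vanish, and X² =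
1 on the target. -/
theorem cnotMatrix_mul_self {c t : Fin n} (h : c ≠ t) : cnotMatrix c t * cnotMatrix c t = 1 := by
  have hX : pauli 1 * pauli 1 = 1 := by
    ext i j; fin_cases i <;> fin_cases j <;> simp [pauli]
  have h00 : (!![1, 0; 0, 0] : Matrix (Fin 2) (Fin 2) ℂ) * !![1, 0; 0, 0] = !![1, 0; 0, 0] := by
    ext i j; fin_cases i <;> fin_cases j <;> simp
  have h01 : (!![1, 0; 0, 0] : Matrix (Fin 2) (Fin 2) ℂ) * !![0, 0; 0, 1] = 0 := by
    ext i j; fin_cases i <;> fin_cases j <;> simp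
  have h10 : (!![0, 0; 0, 1] : Matrix (Fin 2) (Fin 2) ℂ) * !![1, 0; 0, 0] = 0 := by
    ext i j; fin_cases i <;> fin_cases j <;> simp
  have h11 : (!![0, 0; 0, 1] : Matrix (Fin 2) (Fin 2) ℂ) * !![0, 0; 0, 1] = !![0, 0; 0, 1] := by
    ext i j; fin_cases i <;> fin_cases j <;> simp
  have hs : (!![1, 0; 0, 0] : Matrix (Fin 2) (Fin 2) ℂ) + !![0, 0; 0, 1] = 1 := by
    ext i j; fin_cases i <;> fin_cases j <;> simp
  have hz : onQubit c 0 = 0 := by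
    ext x y; simp [onQubit_apply]
  have hc : ∀ A B, onQubit c A * onQubit t B = onQubit t B * onQubit c A :=
    fun A B => (onQubit_commute h A B).eq
  have e1 : onQubit c !![0, 0; 0, 1] * onQubit t (pauli 1) * onQubit c !![1, 0; 0, 0] = 0 := by
    rw [mul_assoc, ← hc, ← mul_assoc, onQubit_mul, h10, hz, zero_mul]
  have e2 : onQubit c !![1, 0; 0, 0] * (onQubit c !![0, 0; 0, 1] * onQubit t (pauli 1)) = 0 := by
    rw [← mul_assoc, onQubit_mul, h01, hz, zero_mul]
  have e3 : onQubit c !![0, 0; 0, 1] * onQubit t (pauli 1) *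
      (onQubit c !![0, 0; 0, 1] * onQubit t (pauli 1)) = onQubit c !![0, 0; 0, 1] := by
    rw [(onQubit_commute h.symm _ _).mul_mul_mul_comm, onQubit_mul, onQubit_mul, h11, hX,
      onQubit_one, mul_one]
  rw [cnotMatrix, add_mul, mul_add, mul_add, e1, e2, e3, onQubit_mul, h00, add_zero, zero_add,
    ← onQubit_add, hs, onQubit_one]

theorem cnotMatrix_commute_onQubit {c t q : Fin n} (hc : c ≠ q) (ht : t ≠ q)
    (A : Matrix (Fin 2) (Fin 2) ℂ) : Commute (cnotMatrix c t) (onQubit q A) :=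
  (onQubit_commute hc _ _).add_left
    ((onQubit_commute hc _ _).mul_left (onQubit_commute ht _ _))

theorem cnotMatrix_commute_target {c t : Fin n} (hc : c ≠ t) :
    Commute (cnotMatrix c t) (onQubit t (pauli 1)) :=
  (onQubit_commute hc _ _).add_left ((onQubit_commute hc _ _).mul_left (Commute.refl _))

theorem Gate.toMatrix_unitary (θ : P → ℝ) (g : Gate n P) : (g.toMatrix θ)ᴴ * g.toMatrix θ = 1 := by
  cases g with
  | ry p q =>
    simp only [Gate.toMatrix]
    rw [onQubit_conjTranspose, onQubit_mul, rotY_conjTranspose_mul_self, onQubit_one]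
  | cnot c t h =>
    simp only [Gate.toMatrix]
    rw [cnotMatrix_conjTranspose h, cnotMatrix_mul_self h]

theorem circuitMatrix_unitary (θ : P → ℝ) (C : List (Gate n P)) :
    (circuitMatrix θ C)ᴴ * circuitMatrix θ C = 1 := by
  induction C with
  | nil => simp [circuitMatrix]
  | cons g C ih =>
    rw [circuitMatrix, Matrix.conjTranspose_mul, mul_assoc, ← mul_assoc _ (circuitMatrix θ C), ih,
      one_mul, g.toMatrix_unitary]

theorem circuitMatrix_append (θ : P → ℝ) (C D : List (Gate n P)) :
    circuitMatrix θ (C ++ D) = circuitMatrix θ D * circuitMatrix θ C := by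
  induction C with
  | nil => simp [circuitMatrix]
  | cons g C ih => simp [circuitMatrix, ih, mul_assoc]

/-- The parameter of a gate, if it has one. -/
def Gate.param : Gate n P → Option P
  | .ry p _ => some p
  | .cnot _ _ _ => none

/-- The parameters of a circuit, in the order of the gates. -/
def params (C : List (Gate n P)) : List P := C.filterMap Gate.param

theorem params_append (C D : List (Gate n P)) : params (C ++ D) = params C ++ params D :=
  List.filterMap_append ..

theorem Gate.toMatrix_congr {θ θ' : P → ℝ} (g : Gate n P) (h : ∀ p, g.param = some p → θ p = θ' p) :
    g.toMatrix θ = g.toMatrix θ' := by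
  cases g with
  | ry p q => simp only [Gate.toMatrix, h p rfl]
  | cnot c t _ => rfl

theorem circuitMatrix_congr {θ θ' : P → ℝ} (C : List (Gate n P))
    (h : ∀ p ∈ params C, θ p = θ' p) : circuitMatrix θ C = circuitMatrix θ' C := by
  induction C with
  | nil => rfl
  | cons g C ih =>
    have hp : ∀ p, p ∈ params (g :: C) ↔ g.param = some p ∨ p ∈ params C := by
      intro p; simp [params]
    rw [circuitMatrix, circuitMatrix, ih fun p hC => h p ((hp p).2 (Or.inr hC)),
      g.toMatrix_congr fun p hg => h p ((hp p).2 (Or.inl hg))]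

end Gates

/-! ### Expectation values of observables -/

section Mean

open Matrix

variable {n : ℕ} {P : Type}

/-- `Re Tr[O V(θ) ρ V(θ)†]`, where `V(θ)` is the operator of the circuit `C`. -/
def mean (O : QMatrix n) (C : List (Gate n P)) (ρ : QMatrix n) (θ : P → ℝ) : ℝ :=
  (O * circuitMatrix θ C * ρ * (circuitMatrix θ C)ᴴ).trace.re

theorem mean_add (O O' : QMatrix n) (C : List (Gate n P)) (ρ : QMatrix n) (θ : P → ℝ) :
    mean (O + O') C ρ θ = mean O C ρ θ + mean O' C ρ θ := by
  simp [mean, add_mul]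

theorem mean_smul (c : ℝ) (O : QMatrix n) (C : List (Gate n P)) (ρ : QMatrix n) (θ : P → ℝ) :
    mean ((c : ℂ) • O) C ρ θ = c * mean O C ρ θ := by
  simp [mean]

theorem mean_nil (O ρ : QMatrix n) (θ : P → ℝ) :
    mean O ([] : List (Gate n P)) ρ θ = (O * ρ).trace.re := by
  simp [mean, circuitMatrix]

theorem mean_append_singleton (O : QMatrix n) (C : List (Gate n P)) (g : Gate n P) (ρ : QMatrix n)
    (θ : P → ℝ) :
    mean O (C ++ [g]) ρ θ = mean ((g.toMatrix θ)ᴴ * O * g.toMatrix θ) C ρ θ := by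
  have h : circuitMatrix θ [g] = g.toMatrix θ := by simp [circuitMatrix]
  rw [mean, mean, circuitMatrix_append, h, Matrix.conjTranspose_mul, ← mul_assoc,
    Matrix.trace_mul_comm]
  simp only [mul_assoc]

theorem mean_append_of_commute {O : QMatrix n} (C : List (Gate n P)) (g : Gate n P)
    (ρ : QMatrix n) (θ : P → ℝ) (h : Commute (g.toMatrix θ) O) :
    mean O (C ++ [g]) ρ θ = mean O C ρ θ := by
  rw [mean_append_singleton, mul_assoc, ← h.eq, ← mul_assoc, g.toMatrix_unitary, one_mul]

theorem mean_congr (O : QMatrix n) (C : List (Gate n P)) (ρ : QMatrix n) {θ θ' : P → ℝ}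
    (h : ∀ p ∈ params C, θ p = θ' p) : mean O C ρ θ = mean O C ρ θ' := by
  rw [mean, mean, circuitMatrix_congr C h]

theorem mean_add_single_of_notMem [DecidableEq P] (O : QMatrix n) {C : List (Gate n P)}
    (ρ : QMatrix n) {p : P} (hp : p ∉ params C) (θ : P → ℝ) (t : ℝ) :
    mean O C ρ (θ + Pi.single p t) = mean O C ρ θ := by
  refine mean_congr O C ρ fun r hr => ?_
  have h : r ≠ p := fun h => hp (h ▸ hr)
  simp [h]

/-- As a function of a parameter that occurs at most once, the mean is a trigonometric
polynomial of degree one in the doubled angle. -/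
theorem exists_mean_add_single_eq [DecidableEq P] (O : QMatrix n) {C : List (Gate n P)}
    (hC : (params C).Nodup) (ρ : QMatrix n) (p : P) (θ : P → ℝ) :
    ∃ a b c : ℝ, ∀ t : ℝ, mean O C ρ (θ + Pi.single p t) =
      a + b * Real.cos (2 * t) + c * Real.sin (2 * t) := by
  -- The gate only sees the total angle θ p + t; the addition formulas then absorb θ p into the
  -- coefficients.
  suffices h : ∃ a b c : ℝ, ∀ t : ℝ, mean O C ρ (θ + Pi.single p t) =
      a + b * Real.cos (2 * (θ p + t)) + c * Real.sin (2 * (θ p + t)) by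
    obtain ⟨a, b, c, h⟩ := h
    refine ⟨a, b * Real.cos (2 * θ p) + c * Real.sin (2 * θ p),
      c * Real.cos (2 * θ p) - b * Real.sin (2 * θ p), fun t => ?_⟩
    rw [h, mul_add, Real.cos_add, Real.sin_add]
    ring
  -- Removing the last gate conjugates the observable, so `O` must vary.
  induction C using List.reverseRecOn generalizing O with
  | nil => exact ⟨(O * ρ).trace.re, 0, 0, fun t => by simp [mean_nil]⟩
  | append_singleton C g ih =>
    rw [params_append, List.nodup_append] at hC
    by_cases hg : g.param = some p
    · have hp : p ∉ params C := fun hp => hC.2.2 p hp p (by simp [params, hg]) rfl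
      cases g with
      | cnot c t _ => simp [Gate.param] at hg
      | ry r q =>
        obtain rfl : r = p := by simpa [Gate.param] using hg
        set J : QMatrix n := onQubit q !![0, -1; 1, 0]
        -- The rotation is cos τ + sin τ J, so conjugation gives cos² O + sin² JᴴOJ + cos sin (OJ +
        -- JᴴO); these are its coefficients in the double angle.
        refine ⟨(mean O C ρ θ + mean (Jᴴ * O * J) C ρ θ) / 2,
          (mean O C ρ θ - mean (Jᴴ * O * J) C ρ θ) / 2,
          (mean (O * J) C ρ θ + mean (Jᴴ * O) C ρ θ) / 2, fun t => ?_⟩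
        rw [mean_append_singleton, mean_add_single_of_notMem _ _ hp]
        set τ := θ r + t with hτ
        have hR : (Gate.ry r q : Gate n P).toMatrix (θ + Pi.single r t) =
            (Real.cos τ : ℂ) • 1 + (Real.sin τ : ℂ) • J := by
          simp only [Gate.toMatrix, Pi.add_apply, Pi.single_eq_same]
          rw [rotY_eq_add, onQubit_add, onQubit_smul, onQubit_smul, onQubit_one]
        have hexp : ((Gate.ry r q : Gate n P).toMatrix (θ + Pi.single r t))ᴴ * O *
              (Gate.ry r q : Gate n P).toMatrix (θ + Pi.single r t) =
            ((Real.cos τ ^ 2 : ℝ) : ℂ) • O + ((Real.sin τ ^ 2 : ℝ) : ℂ) • (Jᴴ * O * J) +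
              ((Real.cos τ * Real.sin τ : ℝ) : ℂ) • (O * J + Jᴴ * O) := by
          rw [hR]
          simp only [Matrix.conjTranspose_add, Matrix.conjTranspose_smul,
            Matrix.conjTranspose_one, Complex.star_def, Complex.conj_ofReal, add_mul, mul_add,
            Matrix.smul_mul, Matrix.mul_smul, one_mul, mul_one, smul_add, smul_smul,
            Complex.ofReal_mul, pow_two]
          rw [mul_comm (Real.sin τ : ℂ) (Real.cos τ : ℂ)]
          abel
        rw [hexp, mean_add, mean_add, mean_smul, mean_smul, mean_smul, mean_add,
          Real.cos_two_mul', Real.sin_two_mul]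
        linear_combination ((mean O C ρ θ + mean (Jᴴ * O * J) C ρ θ) / 2) *
          (Real.cos_sq_add_sin_sq τ)
    · obtain ⟨a, b, c, h⟩ := ih ((g.toMatrix θ)ᴴ * O * g.toMatrix θ) hC.1
      refine ⟨a, b, c, fun t => ?_⟩
      rw [← h, mean_append_singleton, g.toMatrix_congr (θ' := θ)]
      intro r hr
      have hrp : r ≠ p := fun h => hg (h ▸ hr)
      simp [hrp]

/-- Z is the difference of two projections with sum 1. Their means in the evolved state are
nonnegative and add up to 1. -/
theorem abs_mean_firstPauli_three_le [NeZero n] (C : List (Gate n P)) {ρ : QMatrix n}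
    (hρ : IsState ρ) (θ : P → ℝ) : |mean (firstPauli 3) C ρ θ| ≤ 1 := by
  set V := circuitMatrix θ C
  have hM : (V * ρ * Vᴴ).PosSemidef := hρ.1.mul_mul_conjTranspose_same V
  have htr : (V * ρ * Vᴴ).trace = 1 := by
    rw [Matrix.trace_mul_comm, ← mul_assoc, circuitMatrix_unitary, one_mul, hρ.2]
  have key : ∀ A : Matrix (Fin 2) (Fin 2) ℂ, Aᴴ * A = A →
      0 ≤ (onQubit 0 A * (V * ρ * Vᴴ)).trace.re := by
    intro A hA
    have h := (hM.mul_mul_conjTranspose_same (onQubit 0 A)).trace_nonneg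
    rw [Matrix.trace_mul_comm, ← mul_assoc, onQubit_conjTranspose, onQubit_mul, hA] at h
    exact (Complex.le_def.1 h).1
  have h0 := key !![1, 0; 0, 0] (by
    ext i j; fin_cases i <;> fin_cases j <;> simp [Matrix.mul_apply, Fin.sum_univ_two])
  have h1 := key !![0, 0; 0, 1] (by
    ext i j; fin_cases i <;> fin_cases j <;> simp [Matrix.mul_apply, Fin.sum_univ_two])
  have hs : (onQubit 0 !![1, 0; 0, 0] : QMatrix n) + onQubit 0 !![0, 0; 0, 1] = 1 := by
    rw [← onQubit_add, ← onQubit_one (0 : Fin n)]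
    congr 1
    ext i j; fin_cases i <;> fin_cases j <;> simp
  have hZ : (firstPauli 3 : QMatrix n) =
      onQubit 0 !![1, 0; 0, 0] + (-1 : ℂ) • onQubit 0 !![0, 0; 0, 1] := by
    rw [firstPauli_eq, ← onQubit_smul, ← onQubit_add]
    congr 1
    ext i j; fin_cases i <;> fin_cases j <;> simp [pauli]
  have hsum := congrArg (fun A => (A * (V * ρ * Vᴴ)).trace.re) hs
  simp only [add_mul, one_mul, Matrix.trace_add, htr, Complex.add_re, Complex.one_re] at hsum
  have hm : mean (firstPauli 3) C ρ θ = (onQubit 0 !![1, 0; 0, 0] * (V * ρ * Vᴴ)).trace.re -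
      (onQubit 0 !![0, 0; 0, 1] * (V * ρ * Vᴴ)).trace.re := by
    rw [mean, mul_assoc, mul_assoc, ← mul_assoc V, hZ, add_mul]
    simp [V, sub_eq_add_neg]
  rw [hm, abs_le]
  constructor <;> linarith

end Mean

/-! ### Differentiability -/

section Regularity

open Matrix

variable {n : ℕ} {P : Type}

theorem contDiff_toMatrix_apply [Fintype P] (g : Gate n P) (x y : Fin n → Fin 2) :
    ContDiff ℝ 1 fun θ : P → ℝ => g.toMatrix θ x y := by
  cases g with
  | cnot c t _ => exact contDiff_const
  | ry p q =>
    simp only [Gate.toMatrix, rotY_eq_add, onQubit_add, onQubit_smul, Matrix.add_apply,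
      Matrix.smul_apply, smul_eq_mul]
    have hp : ContDiff ℝ 1 fun θ : P → ℝ => θ p := contDiff_apply ℝ ℝ p
    exact ((Complex.ofRealCLM.contDiff.comp hp.cos).mul contDiff_const).add
      ((Complex.ofRealCLM.contDiff.comp hp.sin).mul contDiff_const)

theorem contDiff_circuitMatrix_apply [Fintype P] (C : List (Gate n P)) (x y : Fin n → Fin 2) :
    ContDiff ℝ 1 fun θ : P → ℝ => circuitMatrix θ C x y := by
  induction C generalizing x y with
  | nil => exact contDiff_const
  | cons g C ih =>
    simp only [circuitMatrix, Matrix.mul_apply]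
    exact ContDiff.sum fun z _ => (ih x z).mul (contDiff_toMatrix_apply g z y)

theorem contDiff_mean [Fintype P] (O : QMatrix n) (C : List (Gate n P)) (ρ : QMatrix n) :
    ContDiff ℝ 1 (mean O C ρ) := by
  have h : ContDiff ℝ 1 fun θ : P → ℝ =>
      (O * circuitMatrix θ C * ρ * (circuitMatrix θ C)ᴴ).trace := by
    simp only [Matrix.trace, Matrix.diag, Matrix.mul_apply, Matrix.conjTranspose_apply]
    refine ContDiff.sum fun i _ => ContDiff.sum fun j _ => ContDiff.mul
      (ContDiff.sum fun k _ => ContDiff.mul (ContDiff.sum fun l _ =>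
        contDiff_const.mul (contDiff_circuitMatrix_apply C l k)) contDiff_const) ?_
    exact Complex.conjCLE.contDiff.comp (contDiff_circuitMatrix_apply C i j)
  exact Complex.reCLM.contDiff.comp h

theorem continuous_mean [Fintype P] (O : QMatrix n) (C : List (Gate n P)) (ρ : QMatrix n) :
    Continuous (mean O C ρ) := (contDiff_mean O C ρ).continuous

theorem objective_eq [NeZero n] (C : List (Gate n P)) (ρ : QMatrix n) (θ : EuclideanSpace ℝ P) :
    objective C ρ θ = 1 / 2 + 1 / 2 * mean (firstPauli 3) C ρ θ := rfl

theorem differentiable_objective [NeZero n] [Fintype P] (C : List (Gate n P)) (ρ : QMatrix n) :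
    Differentiable ℝ (objective C ρ) := by
  have h : Differentiable ℝ (mean (firstPauli 3) C ρ) :=
    (contDiff_mean _ C ρ).differentiable one_ne_zero
  have h2 : Differentiable ℝ fun θ : EuclideanSpace ℝ P => mean (firstPauli 3) C ρ θ :=
    h.comp (PiLp.continuousLinearEquiv 2 ℝ fun _ : P => ℝ).differentiable
  exact (h2.const_mul (1 / 2)).const_add (1 / 2)

/-- The central difference of `F` in the coordinate `p`, with step `π / 4`. -/
def centralDiff [DecidableEq P] (p : P) (F : (P → ℝ) → ℝ) (θ : P → ℝ) : ℝ :=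
  (F (θ + Pi.single p (Real.pi / 4)) - F (θ + Pi.single p (-(Real.pi / 4)))) / 2

/-- The parameter-shift rule. -/
theorem gradient_objective_apply [NeZero n] [Fintype P] [DecidableEq P] {C : List (Gate n P)}
    (hC : (params C).Nodup) (ρ : QMatrix n) (θ : P → ℝ) (p : P) :
    gradient (objective C ρ) (WithLp.toLp 2 θ) p =
      centralDiff p (mean (firstPauli 3) C ρ) θ := by
  obtain ⟨a, b, c, h⟩ := exists_mean_add_single_eq (firstPauli 3) hC ρ p θ
  have hd := (differentiable_objective C ρ) (WithLp.toLp 2 θ)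
  have hl : HasDerivAt (fun t : ℝ => WithLp.toLp 2 θ + t • EuclideanSpace.single p (1 : ℝ))
      (EuclideanSpace.single p (1 : ℝ)) 0 := by
    simpa using ((hasDerivAt_id (0 : ℝ)).smul_const (EuclideanSpace.single p (1 : ℝ))).const_add
      (WithLp.toLp 2 θ)
  have h1 : HasDerivAt
      (fun t : ℝ => objective C ρ (WithLp.toLp 2 θ + t • EuclideanSpace.single p (1 : ℝ)))
      (fderiv ℝ (objective C ρ) (WithLp.toLp 2 θ) (EuclideanSpace.single p 1)) 0 := by
    have hf : HasFDerivAt (objective C ρ) (fderiv ℝ (objective C ρ) (WithLp.toLp 2 θ))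
        (WithLp.toLp 2 θ + (0 : ℝ) • EuclideanSpace.single p (1 : ℝ)) := by
      simpa using hd.hasFDerivAt
    exact hf.comp_hasDerivAt (0 : ℝ) hl
  have hfun : (fun t : ℝ => objective C ρ (WithLp.toLp 2 θ + t • EuclideanSpace.single p (1 : ℝ)))
      = fun t => 1 / 2 + 1 / 2 * (a + b * Real.cos (2 * t) + c * Real.sin (2 * t)) := by
    funext t
    rw [objective_eq, ← h]
    congr 3
    ext r
    by_cases hr : r = p
    · subst hr; simp
    · simp [hr]
  have h2 : HasDerivAt (fun t : ℝ =>
      1 / 2 + 1 / 2 * (a + b * Real.cos (2 * t) + c * Real.sin (2 * t))) c 0 := by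
    have hlin : HasDerivAt (fun t : ℝ => 2 * t) 2 0 := by
      simpa using (hasDerivAt_id (0 : ℝ)).const_mul 2
    have := (((hlin.cos.const_mul b).const_add a).add (hlin.sin.const_mul c)).const_mul (1 / 2)
      |>.const_add (1 / 2)
    convert! this using 1
    simp
    ring
  rw [hfun] at h1
  -- The factor 1/2 of the objective cancels the 2 from the doubled angle, leaving c; the shifts by
  -- π/4 below evaluate the sine at ±π/2 and give c too.
  have hg : gradient (objective C ρ) (WithLp.toLp 2 θ) p = c := by
    rw [← h1.unique h2, ← inner_gradient_left, EuclideanSpace.inner_single_right]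
    simp
  rw [hg, centralDiff, h, h]
  have e1 : 2 * (Real.pi / 4) = Real.pi / 2 := by ring
  have e2 : 2 * -(Real.pi / 4) = -(Real.pi / 2) := by ring
  rw [e1, e2]
  simp

theorem sqGradNorm_objective [NeZero n] [Fintype P] [DecidableEq P] {C : List (Gate n P)}
    (hC : (params C).Nodup) (ρ : QMatrix n) (θ : P → ℝ) :
    sqGradNorm (objective C ρ) θ = ∑ p, centralDiff p (mean (firstPauli 3) C ρ) θ ^ 2 := by
  rw [sqGradNorm, EuclideanSpace.norm_sq_eq]
  refine Finset.sum_congr rfl fun p _ => ?_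
  rw [gradient_objective_apply hC, Real.norm_eq_abs, sq_abs]

theorem continuous_centralDiff [DecidableEq P] (p : P) {F : (P → ℝ) → ℝ} (hF : Continuous F) :
    Continuous (centralDiff p F) := by
  unfold centralDiff
  fun_prop

theorem sqGradNorm_objective_le [NeZero n] [Fintype P] {C : List (Gate n P)}
    (hC : (params C).Nodup) {ρ : QMatrix n} (hρ : IsState ρ) (θ : P → ℝ) :
    sqGradNorm (objective C ρ) θ ≤ Fintype.card P := by
  classical
  rw [sqGradNorm_objective hC, Fintype.card, Finset.cast_card]
  refine Finset.sum_le_sum fun p _ => ?_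
  rw [sq_le_one_iff_abs_le_one, centralDiff, abs_le]
  have h1 := abs_le.1 (abs_mean_firstPauli_three_le C hρ (θ + Pi.single p (Real.pi / 4)))
  have h2 := abs_le.1 (abs_mean_firstPauli_three_le C hρ (θ + Pi.single p (-(Real.pi / 4))))
  constructor <;> linarith [h1.1, h1.2, h2.1, h2.2]

end Regularity

/-! ### The uniform law of the parameters -/

section Law

variable {P : Type} [Fintype P]

theorem isProbabilityMeasure_cond_Icc :
    IsProbabilityMeasure (ProbabilityTheory.cond volume (Set.Icc (0 : ℝ) (2 * Real.pi))) := by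
  refine ProbabilityTheory.cond_isProbabilityMeasure_of_finite ?_ ?_
  · simp [Real.volume_Icc, Real.pi_pos]
  · rw [Real.volume_Icc]
    exact ENNReal.ofReal_ne_top

instance isProbabilityMeasure_uniformParams : IsProbabilityMeasure (uniformParams P) := by
  have := isProbabilityMeasure_cond_Icc
  unfold uniformParams
  infer_instance

/-- The law is carried by a compact cube, so continuity suffices. -/
theorem integrable_uniformParams {F : (P → ℝ) → ℝ} (hF : Continuous F) :
    Integrable F (uniformParams P) := by
  have := isProbabilityMeasure_cond_Icc
  have hK : IsCompact (Set.univ.pi fun _ : P => Set.Icc (0 : ℝ) (2 * Real.pi)) :=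
    isCompact_univ_pi fun _ => isCompact_Icc
  have hmem : ∀ᵐ θ ∂uniformParams P,
      θ ∈ Set.univ.pi fun _ : P => Set.Icc (0 : ℝ) (2 * Real.pi) := by
    simp only [Set.mem_univ_pi]
    refine ae_all_iff.2 fun p => ?_
    exact (Measure.tendsto_eval_ae_ae (μ := fun _ : P => ProbabilityTheory.cond volume
      (Set.Icc (0 : ℝ) (2 * Real.pi))) (i := p)).eventually
        (ProbabilityTheory.ae_cond_mem measurableSet_Icc)
  rw [← Measure.restrict_eq_self_of_ae_mem hmem]
  exact hF.continuousOn.integrableOn_compact hK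

/-- A periodic function has the same integral over every period. The lower-integral form fits the
iterated `lmarginal` of the product measure. -/
theorem lintegral_cond_Icc_add {G : ℝ → ℝ} (hG : Continuous G) (h0 : ∀ t, 0 ≤ G t)
    (hp : Function.Periodic G (2 * Real.pi)) (s : ℝ) :
    ∫⁻ t, ENNReal.ofReal (G (t + s)) ∂ProbabilityTheory.cond volume (Set.Icc 0 (2 * Real.pi)) =
      ∫⁻ t, ENNReal.ofReal (G t) ∂ProbabilityTheory.cond volume (Set.Icc 0 (2 * Real.pi)) := by
  have hpi : (0 : ℝ) ≤ 2 * Real.pi := by positivity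
  have key : ∀ H : ℝ → ℝ, Continuous H → (∀ t, 0 ≤ H t) →
      ∫⁻ t in Set.Icc 0 (2 * Real.pi), ENNReal.ofReal (H t) =
        ENNReal.ofReal (∫ t in (0 : ℝ)..2 * Real.pi, H t) := by
    intro H hH hH0
    rw [intervalIntegral.integral_of_le hpi, ← integral_Icc_eq_integral_Ioc,
      ofReal_integral_eq_lintegral_ofReal hH.continuousOn.integrableOn_Icc
        (Filter.Eventually.of_forall hH0)]
  rw [ProbabilityTheory.cond, lintegral_smul_measure, lintegral_smul_measure, key G hG h0,
    key (fun t => G (t + s)) (by fun_prop) fun t => h0 _,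
    intervalIntegral.integral_comp_add_right (fun t => G t) s, zero_add, add_comm (2 * Real.pi),
    hp.intervalIntegral_add_eq s 0, zero_add]

theorem integral_uniformParams_add_single [DecidableEq P] {F : (P → ℝ) → ℝ} (hF : Continuous F)
    (h0 : ∀ θ, 0 ≤ F θ) (p : P) (hp : ∀ θ, F (θ + Pi.single p (2 * Real.pi)) = F θ) (s : ℝ) :
    ∫ θ, F (θ + Pi.single p s) ∂uniformParams P = ∫ θ, F θ ∂uniformParams P := by
  have := isProbabilityMeasure_cond_Icc
  have hs : Continuous fun θ : P → ℝ => F (θ + Pi.single p s) := by fun_prop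
  rw [integral_eq_lintegral_of_nonneg_ae (Filter.Eventually.of_forall h0)
      hF.aestronglyMeasurable,
    integral_eq_lintegral_of_nonneg_ae (Filter.Eventually.of_forall fun θ => h0 _)
      hs.aestronglyMeasurable]
  congr 1
  have hm : Measurable fun θ : P → ℝ => ENNReal.ofReal (F θ) := hF.measurable.ennreal_ofReal
  have hms : Measurable fun θ : P → ℝ => ENNReal.ofReal (F (θ + Pi.single p s)) :=
    hs.measurable.ennreal_ofReal
  -- Coordinate `p` becomes the innermost integral, the only one that the shift affects.
  rw [uniformParams, lintegral_eq_lmarginal_univ (0 : P → ℝ),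
    lintegral_eq_lmarginal_univ (0 : P → ℝ), lmarginal_erase' _ hm (Finset.mem_univ p),
    lmarginal_erase' _ hms (Finset.mem_univ p)]
  congr 1
  funext θ
  have hupd : ∀ t u : ℝ, Function.update θ p t + Pi.single p u = Function.update θ p (t + u) := by
    intro t u
    ext r
    by_cases h : r = p
    · subst h; simp
    · simp [h]
  simp only [hupd]
  refine lintegral_cond_Icc_add (G := fun t => F (Function.update θ p t)) ?_ (fun t => h0 _) ?_ s
  · exact hF.comp (continuous_const.update p continuous_id)
  · intro t
    simp only [← hupd, hp]

/-- Averaging the square of a rotated pair over the rotation angle. -/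
theorem integral_rotated_sq [DecidableEq P] {u v w : (P → ℝ) → ℝ} (hu : Continuous u)
    (hv : Continuous v) (p : P) (hup : ∀ θ t, u (θ + Pi.single p t) = u θ)
    (hvp : ∀ θ t, v (θ + Pi.single p t) = v θ)
    {ε : ℝ} (hε : ε ^ 2 = 1)
    (hw : ∀ θ, w θ = Real.cos (2 * θ p) * u θ + ε * Real.sin (2 * θ p) * v θ) :
    ∫ θ, w θ ^ 2 ∂uniformParams P =
      (∫ θ, u θ ^ 2 ∂uniformParams P + ∫ θ, v θ ^ 2 ∂uniformParams P) / 2 := by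
  have hc : Continuous w := by
    rw [funext hw]
    fun_prop
  -- A shift by π/4 is a quarter turn of the doubled angle. It preserves the integral of w², while
  -- w² plus its shift is u² + v² pointwise, so no cross term has to be integrated.
  have hshift := integral_uniformParams_add_single (F := fun θ => w θ ^ 2) (hc.pow 2)
    (fun θ => sq_nonneg _) p
    (fun θ => by
      simp only [hw, Pi.add_apply, Pi.single_eq_same, hup, hvp, mul_add]
      rw [show 2 * (2 * Real.pi) = 2 * Real.pi + 2 * Real.pi by ring, ← add_assoc,
        Real.cos_add_two_pi, Real.cos_add_two_pi, Real.sin_add_two_pi, Real.sin_add_two_pi])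
    (Real.pi / 4)
  have hsum : ∫ θ, (w θ ^ 2 + w (θ + Pi.single p (Real.pi / 4)) ^ 2) ∂uniformParams P =
      ∫ θ, (u θ ^ 2 + v θ ^ 2) ∂uniformParams P := by
    congr 1
    funext θ
    simp only [hw, Pi.add_apply, Pi.single_eq_same, hup, hvp, mul_add]
    rw [show 2 * (Real.pi / 4) = Real.pi / 2 by ring, Real.cos_add_pi_div_two,
      Real.sin_add_pi_div_two]
    linear_combination (u θ ^ 2 + ε ^ 2 * v θ ^ 2) * Real.cos_sq_add_sin_sq (2 * θ p) +
      v θ ^ 2 * hε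
  rw [integral_add (integrable_uniformParams (by fun_prop))
      (integrable_uniformParams (by fun_prop)), hshift,
    integral_add (integrable_uniformParams (by fun_prop))
      (integrable_uniformParams (by fun_prop))] at hsum
  linarith

end Law

/-! ### Second moments of the means of `σ₁` and `σ₃` on the first qubit -/

section SecondMoments

variable {n : ℕ} [NeZero n] {P : Type}

/-- The factor 1 here, and -1 for σ₃, is the sign `ε` of `integral_rotated_sq`. -/
theorem mean_one_append_ry (C : List (Gate n P)) (p : P) (ρ : QMatrix n) (θ : P → ℝ) :
    mean (firstPauli 1) (C ++ [Gate.ry p 0]) ρ θ =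
      Real.cos (2 * θ p) * mean (firstPauli 1) C ρ θ +
        1 * Real.sin (2 * θ p) * mean (firstPauli 3) C ρ θ := by
  rw [mean_append_singleton, Gate.toMatrix, firstPauli_eq, firstPauli_eq, onQubit_conjTranspose,
    onQubit_mul, onQubit_mul, rotY_conj_pauli_one, onQubit_add, onQubit_smul, onQubit_smul,
    mean_add, mean_smul, mean_smul, one_mul]

theorem mean_three_append_ry (C : List (Gate n P)) (p : P) (ρ : QMatrix n) (θ : P → ℝ) :
    mean (firstPauli 3) (C ++ [Gate.ry p 0]) ρ θ =
      Real.cos (2 * θ p) * mean (firstPauli 3) C ρ θ +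
        -1 * Real.sin (2 * θ p) * mean (firstPauli 1) C ρ θ := by
  rw [mean_append_singleton, Gate.toMatrix, firstPauli_eq, firstPauli_eq, onQubit_conjTranspose,
    onQubit_mul, onQubit_mul, rotY_conj_pauli_three, onQubit_add, onQubit_smul, onQubit_smul,
    mean_add, mean_smul, ← Complex.ofReal_neg, mean_smul, neg_one_mul]

theorem mean_one_append_cnot (C : List (Gate n P)) {c : Fin n} (h : c ≠ 0) (ρ : QMatrix n)
    (θ : P → ℝ) :
    mean (firstPauli 1) (C ++ [Gate.cnot c 0 h]) ρ θ = mean (firstPauli 1) C ρ θ := by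
  refine mean_append_of_commute C _ ρ θ ?_
  rw [firstPauli_eq]
  exact cnotMatrix_commute_target h

theorem mean_append_ry_of_ne (i : Fin 4) (C : List (Gate n P)) (p : P) {q : Fin n} (h : q ≠ 0)
    (ρ : QMatrix n) (θ : P → ℝ) :
    mean (firstPauli i) (C ++ [Gate.ry p q]) ρ θ = mean (firstPauli i) C ρ θ := by
  refine mean_append_of_commute C _ ρ θ ?_
  rw [firstPauli_eq]
  exact onQubit_commute h _ _

theorem mean_append_cnot_of_ne (i : Fin 4) (C : List (Gate n P)) {c t : Fin n} (h : c ≠ t)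
    (hc : c ≠ 0) (ht : t ≠ 0) (ρ : QMatrix n) (θ : P → ℝ) :
    mean (firstPauli i) (C ++ [Gate.cnot c t h]) ρ θ = mean (firstPauli i) C ρ θ := by
  refine mean_append_of_commute C _ ρ θ ?_
  rw [firstPauli_eq]
  exact cnotMatrix_commute_onQubit hc ht _

/-- How a gate transforms lower bounds for the second moments of the means of `σ₁` and `σ₃` on the
first qubit. -/
def momentStep (v : ℝ × ℝ) : Gate n P → ℝ × ℝ
  | .ry _ q => if q = 0 then ((v.1 + v.2) / 2, (v.1 + v.2) / 2) else v
  | .cnot _ t _ => if t = 0 then (v.1, 0) else v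

/-- The gate is not a CNOT controlled by the first qubit. -/
def Gate.FirstNotControl : Gate n P → Prop
  | .ry _ _ => True
  | .cnot c _ _ => c ≠ 0

variable [Fintype P]

/-- The pair `v` bounds the second moments of the means of `σ₁` and `σ₃` on the first qubit from
below, after an application of the operator `Φ` on functions of the parameters. -/
def SecondMomentGe (Φ : ((P → ℝ) → ℝ) → (P → ℝ) → ℝ) (C : List (Gate n P)) (ρ : QMatrix n)
    (v : ℝ × ℝ) : Prop :=
  v.1 ≤ ∫ θ, Φ (mean (firstPauli 1) C ρ) θ ^ 2 ∂uniformParams P ∧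
    v.2 ≤ ∫ θ, Φ (mean (firstPauli 3) C ρ) θ ^ 2 ∂uniformParams P

/-- The operator `Φ` is abstract so that one argument covers the means themselves and their central
differences in a parameter of an earlier gate. `hlin` and `hinv` say that `Φ` does not interfere
with the new parameter. -/
theorem SecondMomentGe.append_singleton [DecidableEq P] {Φ : ((P → ℝ) → ℝ) → (P → ℝ) → ℝ}
    {C : List (Gate n P)} {ρ : QMatrix n} {v : ℝ × ℝ} (h : SecondMomentGe Φ C ρ v) (g : Gate n P)
    (hg : g.FirstNotControl) (hfresh : ∀ p, g.param = some p → p ∉ params C)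
    (hcont : ∀ u, Continuous u → Continuous (Φ u))
    (hlin : ∀ p, g.param = some p → ∀ (u v w : (P → ℝ) → ℝ) (ε : ℝ),
      (∀ θ, w θ = Real.cos (2 * θ p) * u θ + ε * Real.sin (2 * θ p) * v θ) →
        ∀ θ, Φ w θ = Real.cos (2 * θ p) * Φ u θ + ε * Real.sin (2 * θ p) * Φ v θ)
    (hinv : ∀ p, g.param = some p → ∀ u : (P → ℝ) → ℝ,
      (∀ θ t, u (θ + Pi.single p t) = u θ) → ∀ θ t, Φ u (θ + Pi.single p t) = Φ u θ) :
    SecondMomentGe Φ (C ++ [g]) ρ (momentStep v g) := by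
  obtain ⟨h1, h3⟩ := h
  cases g with
  | ry p q =>
    by_cases hq : q = 0
    · subst hq
      simp only [momentStep, if_true]
      have hp := hfresh p rfl
      have hi : ∀ i, ∀ θ t, Φ (mean (firstPauli i) C ρ) (θ + Pi.single p t) =
          Φ (mean (firstPauli i) C ρ) θ := fun i =>
        hinv p rfl _ fun θ t => mean_add_single_of_notMem _ _ hp θ t
      have hc : ∀ i, Continuous (Φ (mean (firstPauli i) C ρ)) := fun i =>
        hcont _ (continuous_mean _ _ _)
      constructor
      · rw [integral_rotated_sq (hc 1) (hc 3) p (hi 1) (hi 3) (ε := 1) (by norm_num)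
          (hlin p rfl _ _ _ _ (mean_one_append_ry C p ρ))]
        simp only
        linarith
      · rw [integral_rotated_sq (hc 3) (hc 1) p (hi 3) (hi 1) (ε := -1) (by norm_num)
          (hlin p rfl _ _ _ _ (mean_three_append_ry C p ρ))]
        simp only
        linarith
    · simp only [momentStep, if_neg hq]
      constructor
      · rwa [funext (mean_append_ry_of_ne 1 C p hq ρ)]
      · rwa [funext (mean_append_ry_of_ne 3 C p hq ρ)]
  | cnot c t hct =>
    by_cases ht : t = 0
    · subst ht
      simp only [momentStep, if_true]
      constructor
      · rwa [funext (mean_one_append_cnot C hct ρ)]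
      · exact integral_nonneg fun θ => sq_nonneg _
    · simp only [momentStep, if_neg ht]
      constructor
      · rwa [funext (mean_append_cnot_of_ne 1 C hct hg ht ρ)]
      · rwa [funext (mean_append_cnot_of_ne 3 C hct hg ht ρ)]

theorem secondMomentGe_id (C : List (Gate n P)) (hC : (params C).Nodup)
    (hctrl : ∀ g ∈ C, g.FirstNotControl) (ρ : QMatrix n) :
    SecondMomentGe id C ρ (C.foldl momentStep
      ((firstPauli 1 * ρ).trace.re ^ 2, (firstPauli 3 * ρ).trace.re ^ 2)) := by
  classical
  induction C using List.reverseRecOn with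
  | nil => constructor <;> simp [mean_nil]
  | append_singleton C g ih =>
    rw [params_append, List.nodup_append] at hC
    rw [List.foldl_append]
    refine (ih hC.1 fun g hg => hctrl g (List.mem_append_left _ hg)).append_singleton g
      (hctrl g (by simp)) (fun p hp hpC => hC.2.2 p hpC p (by simp [params, hp]) rfl)
      (fun u hu => hu) (fun p _ u v w ε h => h) (fun p _ u h => h)

/-- Up to the gate carrying `p` the moments are those of `secondMomentGe_id`. At that gate the
difference leaves the averaged moment unchanged, and after it the step lemma applies. So derivatives
obey the same bound as the means. -/
theorem secondMomentGe_centralDiff [DecidableEq P] (C : List (Gate n P)) (hC : (params C).Nodup)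
    (hctrl : ∀ g ∈ C, g.FirstNotControl) (ρ : QMatrix n) {p : P} (hp : Gate.ry p 0 ∈ C) :
    SecondMomentGe (centralDiff p) C ρ (C.foldl momentStep
      ((firstPauli 1 * ρ).trace.re ^ 2, (firstPauli 3 * ρ).trace.re ^ 2)) := by
  induction C using List.reverseRecOn with
  | nil => simp at hp
  | append_singleton C g ih =>
    rw [params_append, List.nodup_append] at hC
    have hctrl' : ∀ g ∈ C, g.FirstNotControl := fun g hg => hctrl g (List.mem_append_left _ hg)
    have hfresh : ∀ r, g.param = some r → r ∉ params C := fun r hr hrC =>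
      hC.2.2 r hrC r (by simp [params, hr]) rfl
    rw [List.foldl_append]
    by_cases hg : g = Gate.ry p 0
    · subst hg
      have hpC := hfresh p rfl
      obtain ⟨h1, h3⟩ := secondMomentGe_id C hC.1 hctrl' ρ
      simp only [id] at h1 h3
      have hrot : ∀ (u v w : (P → ℝ) → ℝ) (ε : ℝ), ε ^ 2 = 1 → Continuous u → Continuous v →
          (∀ θ t, u (θ + Pi.single p t) = u θ) → (∀ θ t, v (θ + Pi.single p t) = v θ) →
          (∀ θ, w θ = Real.cos (2 * θ p) * u θ + ε * Real.sin (2 * θ p) * v θ) →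
          ∫ θ, centralDiff p w θ ^ 2 ∂uniformParams P =
            (∫ θ, u θ ^ 2 ∂uniformParams P + ∫ θ, v θ ^ 2 ∂uniformParams P) / 2 := by
        intro u v w ε hε hu hv hup hvp hw
        -- The difference of cos u + ε sin v is -sin u + ε cos v, which is ε times the rotated pair
        -- cos v - ε sin u; the sign disappears in the square.
        rw [add_comm, ← integral_rotated_sq hv hu p hvp hup (ε := -ε) (by rw [neg_sq, hε])
          fun θ => rfl]
        congr 1
        funext θ
        simp only [centralDiff, hw, hup, hvp, Pi.add_apply, Pi.single_eq_same, mul_add]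
        rw [show 2 * -(Real.pi / 4) = -(Real.pi / 2) by ring,
          show 2 * (Real.pi / 4) = Real.pi / 2 by ring, ← sub_eq_add_neg,
          Real.cos_add_pi_div_two, Real.sin_add_pi_div_two, Real.cos_sub_pi_div_two,
          Real.sin_sub_pi_div_two]
        linear_combination (Real.cos (2 * θ p) ^ 2 * v θ ^ 2 -
          Real.sin (2 * θ p) ^ 2 * u θ ^ 2) * hε
      have hi : ∀ i, ∀ θ t, mean (firstPauli i) C ρ (θ + Pi.single p t) =
          mean (firstPauli i) C ρ θ := fun i => mean_add_single_of_notMem _ _ hpC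
      have hc : ∀ i, Continuous (mean (firstPauli i) C ρ) := fun i => continuous_mean _ _ _
      simp only [List.foldl_cons, List.foldl_nil, momentStep, if_true]
      constructor
      · rw [hrot _ _ _ 1 (by norm_num) (hc 1) (hc 3) (hi 1) (hi 3) (mean_one_append_ry C p ρ)]
        simp only
        linarith
      · rw [hrot _ _ _ (-1) (by norm_num) (hc 3) (hc 1) (hi 3) (hi 1)
          (mean_three_append_ry C p ρ)]
        simp only
        linarith
    · have hpC : Gate.ry p 0 ∈ C := by
        rcases List.mem_append.1 hp with h | h
        · exact h
        · exact absurd (List.mem_singleton.1 h).symm hg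
      have hne : ∀ r, g.param = some r → p ≠ r := by
        rintro r hr rfl
        exact hfresh p hr (List.mem_filterMap.2 ⟨_, hpC, rfl⟩)
      refine (ih hC.1 hctrl' hpC).append_singleton g (hctrl g (by simp)) hfresh
        (fun u hu => continuous_centralDiff p hu) ?_ ?_
      · intro r hr u v w ε hw θ
        simp only [centralDiff, hw, Pi.add_apply, Pi.single_eq_of_ne (hne r hr).symm, add_zero]
        ring
      · intro r hr u hu θ t
        simp only [centralDiff, add_right_comm _ (Pi.single r t : P → ℝ), hu]

/-- All rotations of the first qubit share one lower bound; the remaining partial derivatives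
contribute nonnegative terms and are dropped. -/
theorem integral_sqGradNorm_ge {C : List (Gate n P)} (hC : (params C).Nodup)
    (hctrl : ∀ g ∈ C, g.FirstNotControl) (ρ : QMatrix n) (S : Finset P)
    (hS : ∀ p ∈ S, Gate.ry p 0 ∈ C) :
    S.card * (C.foldl momentStep
      ((firstPauli 1 * ρ).trace.re ^ 2, (firstPauli 3 * ρ).trace.re ^ 2)).2 ≤
      ∫ θ, sqGradNorm (objective C ρ) θ ∂uniformParams P := by
  classical
  have hi : ∀ p ∈ Finset.univ, Integrable
      (fun θ => centralDiff p (mean (firstPauli 3) C ρ) θ ^ 2) (uniformParams P) := fun p _ =>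
    integrable_uniformParams ((continuous_centralDiff p (continuous_mean _ _ _)).pow 2)
  simp only [sqGradNorm_objective hC]
  rw [integral_finsetSum _ hi, ← nsmul_eq_mul]
  refine (Finset.card_nsmul_le_sum S _ _ fun p hp =>
    (secondMomentGe_centralDiff C hC hctrl ρ (hS p hp)).2).trans ?_
  exact Finset.sum_le_sum_of_subset_of_nonneg (Finset.subset_univ S) fun p _ _ =>
    integral_nonneg fun θ => sq_nonneg _

theorem integrable_sqGradNorm {C : List (Gate n P)} (hC : (params C).Nodup) (ρ : QMatrix n) :
    Integrable (sqGradNorm (objective C ρ)) (uniformParams P) := by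
  classical
  rw [funext (sqGradNorm_objective hC ρ)]
  exact integrable_uniformParams (continuous_finsetSum _ fun p _ =>
    (continuous_centralDiff p (continuous_mean _ _ _)).pow 2)

theorem integral_sqGradNorm_le {C : List (Gate n P)} (hC : (params C).Nodup) {ρ : QMatrix n}
    (hρ : IsState ρ) :
    ∫ θ, sqGradNorm (objective C ρ) θ ∂uniformParams P ≤ Fintype.card P := by
  refine (integral_mono (integrable_sqGradNorm hC ρ) (integrable_const _)
    (sqGradNorm_objective_le hC hρ)).trans ?_
  simp

end SecondMoments

/-! ### Moment bounds along layers -/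

section Layers

variable {n : ℕ} [NeZero n] {P : Type}

theorem foldl_momentStep_of_idle {L : List (Gate n P)}
    (hL : ∀ g ∈ L, ∀ v, momentStep v g = v) (v : ℝ × ℝ) : L.foldl momentStep v = v := by
  induction L with
  | nil => rfl
  | cons g L ih =>
    rw [List.foldl_cons, hL g (by simp), ih fun g hg => hL g (List.mem_cons_of_mem _ hg)]

/-- For layers in which only the gate of index 0 acts on the first qubit. -/
theorem foldl_momentStep_ofFn {N : ℕ} (hN : 0 < N) (f : Fin N → Gate n P)
    (hf : ∀ j : Fin N, (j : ℕ) ≠ 0 → ∀ v, momentStep v (f j) = v) (v : ℝ × ℝ) :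
    (List.ofFn f).foldl momentStep v = momentStep v (f ⟨0, hN⟩) := by
  obtain ⟨N, rfl⟩ : ∃ M, N = M + 1 := ⟨N - 1, by omega⟩
  rw [List.ofFn_succ, List.foldl_cons, foldl_momentStep_of_idle]
  · rfl
  · intro g hg
    obtain ⟨j, rfl⟩ := List.mem_ofFn.1 hg
    exact hf _ (by simp)

/-- After the initial rotation the two bounds are equal, and they are equal again after each block
of CNOTs and rotations: (a, a) becomes (a, 0), then (a/2, a/2), if the block targets the first
qubit. An item of the list is one such block. -/
theorem foldl_halving {ι : Type} (F : ℝ × ℝ → ι → ℝ × ℝ) (p : ι → Bool)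
    (hF : ∀ a x, F (a, a) x = if p x then (a / 2, a / 2) else (a, a)) (L : List ι) (a : ℝ) :
    L.foldl F (a, a) = (a / 2 ^ L.countP p, a / 2 ^ L.countP p) := by
  induction L generalizing a with
  | nil => simp
  | cons x L ih =>
    rw [List.foldl_cons, hF]
    by_cases hx : p x
    · rw [if_pos hx, ih, List.countP_cons_of_pos hx, pow_succ', div_div]
    · rw [if_neg hx, ih, List.countP_cons_of_neg hx]

end Layers

/-! ### The tree-tensor circuit -/

section TreeTensor

variable {n m : ℕ}

theorem params_ttCircuit (hn : n = 2 ^ m) : params (ttCircuit hn) =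
    (List.finRange (m + 1)).flatMap fun ℓ : Fin (m + 1) =>
      List.ofFn fun j : Fin (2 ^ (m - (ℓ : ℕ))) => (⟨ℓ, j⟩ : TTParam m) := by
  have hr : ∀ ℓ, params (ttRotLayer hn ℓ) =
      List.ofFn fun j : Fin (2 ^ (m - (ℓ : ℕ))) => (⟨ℓ, j⟩ : TTParam m) := by
    intro ℓ
    rw [params, ttRotLayer, List.ofFn_eq_map, List.ofFn_eq_map, List.filterMap_map,
      ← List.filterMap_eq_map]
    rfl
  have hc : ∀ ℓ, params (ttCnotLayer hn ℓ) = [] := by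
    intro ℓ
    rw [params, List.filterMap_eq_nil_iff]
    intro g hg
    obtain ⟨j, rfl⟩ := List.mem_ofFn.1 hg
    rfl
  -- The initial rotation layer is layer 0; the later ones are indexed by successors.
  rw [ttCircuit, params_append, hr, List.finRange_succ, List.flatMap_cons, List.flatMap_map,
    params, List.filterMap_flatMap]
  congr 2
  funext ℓ
  rw [← params, params_append, hc, hr, List.nil_append]

theorem nodup_params_ttCircuit (hn : n = 2 ^ m) : (params (ttCircuit hn)).Nodup := by
  rw [params_ttCircuit, List.nodup_flatMap]
  constructor
  · intro ℓ _
    rw [List.nodup_ofFn]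
    intro i j h
    simpa using h
  · refine List.Pairwise.imp ?_ (List.nodup_finRange (m + 1))
    intro ℓ k hne x hx hx'
    refine hne ?_
    obtain ⟨i, rfl⟩ := List.mem_ofFn.1 hx
    obtain ⟨j, hj⟩ := List.mem_ofFn.1 hx'
    exact (congrArg Sigma.fst hj).symm

theorem mem_ttCircuit_of_mem_ttRotLayer (hn : n = 2 ^ m) (ℓ : Fin (m + 1))
    {g : Gate n (TTParam m)} (hg : g ∈ ttRotLayer hn ℓ) : g ∈ ttCircuit hn := by
  rw [ttCircuit, List.mem_append, List.mem_flatMap]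
  cases ℓ using Fin.cases with
  | zero => exact Or.inl hg
  | succ ℓ => exact Or.inr ⟨ℓ, List.mem_finRange ℓ, List.mem_append_right _ hg⟩

variable [NeZero n]

theorem ttCircuit_firstNotControl (hn : n = 2 ^ m) :
    ∀ g ∈ ttCircuit hn, g.FirstNotControl := by
  have hr : ∀ ℓ, ∀ g ∈ ttRotLayer hn ℓ, g.FirstNotControl := by
    intro ℓ g hg
    obtain ⟨j, rfl⟩ := List.mem_ofFn.1 hg
    trivial
  intro g hg
  rw [ttCircuit, List.mem_append, List.mem_flatMap] at hg
  rcases hg with hg | ⟨ℓ, -, hg⟩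
  · exact hr _ g hg
  · rcases List.mem_append.1 hg with hg | hg
    · obtain ⟨j, rfl⟩ := List.mem_ofFn.1 hg
      simp [Gate.FirstNotControl]
    · exact hr _ g hg

theorem foldl_momentStep_ttRotLayer (hn : n = 2 ^ m) (ℓ : Fin (m + 1)) (v : ℝ × ℝ) :
    (ttRotLayer hn ℓ).foldl momentStep v = ((v.1 + v.2) / 2, (v.1 + v.2) / 2) := by
  rw [ttRotLayer, foldl_momentStep_ofFn (by positivity)]
  · simp [momentStep]
  · intro j hj v
    simp [momentStep, hj]

theorem foldl_momentStep_ttCnotLayer (hn : n = 2 ^ m) (ℓ : Fin m) (v : ℝ × ℝ) :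
    (ttCnotLayer hn ℓ).foldl momentStep v = (v.1, 0) := by
  rw [ttCnotLayer, foldl_momentStep_ofFn (by positivity)]
  · simp [momentStep]
  · intro j hj v
    simp [momentStep, hj]

theorem foldl_momentStep_ttCircuit (hn : n = 2 ^ m) (v : ℝ × ℝ) :
    (ttCircuit hn).foldl momentStep v =
      ((v.1 + v.2) / 2 / 2 ^ m, (v.1 + v.2) / 2 / 2 ^ m) := by
  rw [ttCircuit, List.foldl_append, foldl_momentStep_ttRotLayer, List.foldl_flatMap,
    foldl_halving _ fun _ => true]
  · simp
  · intro a ℓ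
    rw [List.foldl_append, foldl_momentStep_ttCnotLayer, foldl_momentStep_ttRotLayer]
    simp

theorem card_ttParam (m : ℕ) : (Fintype.card (TTParam m) : ℝ) = 2 * 2 ^ m - 1 := by
  have h : Fintype.card (TTParam m) = ∑ ℓ ∈ Finset.range (m + 1), 2 ^ ℓ := by
    rw [Fintype.card_sigma, ← Finset.sum_range_reflect, Finset.sum_range]
    simp
  have hg := Nat.geomSum_eq (le_refl 2) (m + 1)
  rw [h, Nat.cast_sum]
  push_cast
  rw [geom_sum_eq (by norm_num)]
  ring

end TreeTensor

/-! ### The step-controlled circuit -/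

section StepControlled

variable {n : ℕ}

theorem params_scCircuit (n nc : ℕ) : params (scCircuit n nc) =
    (List.finRange n).map Sum.inl ++ (List.finRange (n - 1)).map Sum.inr := by
  rw [scCircuit, params_append, params, params, List.ofFn_eq_map, List.filterMap_map,
    List.filterMap_flatMap, ← List.filterMap_eq_map, List.map_eq_flatMap]
  rfl

theorem nodup_params_scCircuit (n nc : ℕ) : (params (scCircuit n nc)).Nodup := by
  rw [params_scCircuit, List.nodup_append]
  refine ⟨(List.nodup_finRange _).map Sum.inl_injective,
    (List.nodup_finRange _).map Sum.inr_injective, ?_⟩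
  simp

variable [NeZero n]

/-- For `nc = 0` this fails when n ≥ 2: the CNOT with control 1 targets its neighbour, which is the
first qubit. -/
theorem scTarget_eq_zero_iff {nc : ℕ} (hnc : nc ≠ 0) (i : Fin (n - 1)) :
    scTarget n nc i = 0 ↔ n - 1 - (i : ℕ) ≤ nc := by
  rw [Fin.ext_iff, scTarget, Fin.val_zero]
  simp only
  split_ifs with h <;> omega

theorem scCircuit_firstNotControl (n nc : ℕ) [NeZero n] :
    ∀ g ∈ scCircuit n nc, g.FirstNotControl := by
  intro g hg
  rw [scCircuit, List.mem_append, List.mem_flatMap] at hg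
  rcases hg with hg | ⟨i, -, hg⟩
  · obtain ⟨j, rfl⟩ := List.mem_ofFn.1 hg
    trivial
  · simp only [List.mem_cons, List.not_mem_nil, or_false] at hg
    rcases hg with rfl | rfl
    · have := i.2
      rw [Gate.FirstNotControl, Ne, Fin.ext_iff, scControl, Fin.val_zero]
      simp only
      omega
    · trivial

theorem foldl_momentStep_scCircuit (n nc : ℕ) [NeZero n] (v : ℝ × ℝ) :
    (scCircuit n nc).foldl momentStep v =
      ((v.1 + v.2) / 2 /
          2 ^ (Finset.univ.filter fun i : Fin (n - 1) => scTarget n nc i = 0).card,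
        (v.1 + v.2) / 2 /
          2 ^ (Finset.univ.filter fun i : Fin (n - 1) => scTarget n nc i = 0).card) := by
  have hcard : (Finset.univ.filter fun i : Fin (n - 1) => scTarget n nc i = 0).card =
      (List.finRange (n - 1)).countP fun i => decide (scTarget n nc i = 0) := by
    rw [List.countP_eq_length_filter]
    rfl
  have h0 : (List.ofFn fun q : Fin n => (Gate.ry (Sum.inl q) q : Gate n (SCParam n))).foldl
      momentStep v = ((v.1 + v.2) / 2, (v.1 + v.2) / 2) := by
    rw [foldl_momentStep_ofFn (NeZero.pos n)]
    · simp [momentStep]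
    · intro j hj v
      have hj0 : j ≠ 0 := fun h => hj (by simp [h])
      simp [momentStep, hj0]
  rw [hcard, scCircuit, List.foldl_append, h0, List.foldl_flatMap,
    foldl_halving _ fun i => decide (scTarget n nc i = 0)]
  intro a i
  by_cases h : scTarget n nc i = 0 <;> simp [momentStep, h]

theorem card_scTarget_eq_zero {nc : ℕ} (hlt : nc < n) (h0 : nc = 0 → n = 1) :
    (Finset.univ.filter fun i : Fin (n - 1) => scTarget n nc i = 0).card = nc := by
  by_cases hnc : nc = 0
  · have hn := h0 hnc
    subst hn
    simp [hnc]
  · simp only [scTarget_eq_zero_iff hnc]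
    calc (Finset.univ.filter fun i : Fin (n - 1) => n - 1 - (i : ℕ) ≤ nc).card
        = (Finset.univ : Finset (Fin nc)).card := by
          -- The control n - 1 - i runs through 1, …, nc; subtracting 1 gives the index in `Fin nc`.
          refine Finset.card_bij' (fun i hi => ⟨n - 2 - (i : ℕ), ?_⟩)
            (fun j _ => ⟨n - 2 - (j : ℕ), ?_⟩) ?_ ?_ ?_ ?_
          · have := i.2
            have := (Finset.mem_filter.1 hi).2
            omega
          · have := j.2
            omega
          · simp
          · intro j _
            have := j.2
            simp only [Finset.mem_filter, Finset.mem_univ, true_and]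
            omega
          · intro i _
            have := i.2
            ext
            simp only
            omega
          · intro j _
            have := j.2
            ext
            simp only
            omega
      _ = nc := by simp

end StepControlled

end QNN

end

/-! ### The two gradient bounds -/

open QNN in
theorem theorem2 (n : ℕ) [NeZero n] (ρ : QMatrix n) (hρ : IsState ρ) :
    (∀ (m : ℕ) (hn : n = 2 ^ m),
      Differentiable ℝ (objective (ttCircuit hn) ρ) ∧
      Integrable (sqGradNorm (objective (ttCircuit hn) ρ)) (uniformParams (TTParam m)) ∧
      (1 + Real.logb 2 n) / (2 * n) * alpha ρ ≤
        ∫ θ, sqGradNorm (objective (ttCircuit hn) ρ) θ ∂(uniformParams (TTParam m)) ∧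
      ∫ θ, sqGradNorm (objective (ttCircuit hn) ρ) θ ∂(uniformParams (TTParam m)) ≤ 2 * n - 1) ∧
    (∀ nc : ℕ, nc < n → (nc = 0 → n = 1) →
      Differentiable ℝ (objective (scCircuit n nc) ρ) ∧
      Integrable (sqGradNorm (objective (scCircuit n nc) ρ)) (uniformParams (SCParam n)) ∧
      (1 + nc) / 2 ^ (1 + nc) * alpha ρ ≤
        ∫ θ, sqGradNorm (objective (scCircuit n nc) ρ) θ ∂(uniformParams (SCParam n)) ∧
      ∫ θ, sqGradNorm (objective (scCircuit n nc) ρ) θ ∂(uniformParams (SCParam n)) ≤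
        2 * n - 1) := by
  refine ⟨fun m hn => ⟨differentiable_objective _ ρ,
    integrable_sqGradNorm (nodup_params_ttCircuit hn) ρ, ?_, ?_⟩,
    fun nc hlt h0 => ⟨differentiable_objective _ ρ,
    integrable_sqGradNorm (nodup_params_scCircuit n nc) ρ, ?_, ?_⟩⟩
  · have hnR : (n : ℝ) = 2 ^ m := by rw [hn]; push_cast; rfl
    -- Index 0 of each layer rotates the first qubit, which gives m + 1 = 1 + log₂ n parameters.
    let e : Fin (m + 1) ↪ TTParam m :=
      ⟨fun ℓ => ⟨ℓ, ⟨0, by positivity⟩⟩, fun ℓ k h => congrArg Sigma.fst h⟩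
    have h := integral_sqGradNorm_ge (nodup_params_ttCircuit hn) (ttCircuit_firstNotControl hn) ρ
      (Finset.univ.map e) (by
        intro p hp
        obtain ⟨ℓ, -, rfl⟩ := Finset.mem_map.1 hp
        refine mem_ttCircuit_of_mem_ttRotLayer hn ℓ (List.mem_ofFn.2 ⟨⟨0, by positivity⟩, ?_⟩)
        simp [e])
    rw [foldl_momentStep_ttCircuit, Finset.card_map, Finset.card_univ, Fintype.card_fin] at h
    refine le_of_eq_of_le ?_ h
    rw [hnR, Real.logb_pow, Real.logb_self_eq_one (by norm_num), alpha]
    push_cast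
    field_simp
    ring
  · refine (integral_sqGradNorm_le (nodup_params_ttCircuit hn) hρ).trans_eq ?_
    rw [card_ttParam, hn]
    push_cast
    rfl
  · have h := integral_sqGradNorm_ge (nodup_params_scCircuit n nc)
      (scCircuit_firstNotControl n nc) ρ
      -- The initial rotation of the first qubit, and those after the `nc` CNOTs targeting it.
      (({0} : Finset (Fin n)).disjSum
        (Finset.univ.filter fun i : Fin (n - 1) => scTarget n nc i = 0)) (by
        intro p hp
        rw [scCircuit, List.mem_append, List.mem_flatMap]
        rcases Finset.mem_disjSum.1 hp with ⟨q, hq, rfl⟩ | ⟨i, hi, rfl⟩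
        · rw [Finset.mem_singleton.1 hq]
          exact Or.inl (List.mem_ofFn.2 ⟨0, rfl⟩)
        · refine Or.inr ⟨i, List.mem_finRange i, ?_⟩
          simp [(Finset.mem_filter.1 hi).2])
    rw [foldl_momentStep_scCircuit, Finset.card_disjSum, card_scTarget_eq_zero hlt h0,
      Finset.card_singleton] at h
    refine le_of_eq_of_le ?_ h
    rw [alpha, pow_add]
    push_cast
    field_simp
  · refine (integral_sqGradNorm_le (nodup_params_scCircuit n nc) hρ).trans_eq ?_
    have hpos := NeZero.pos n
    rw [Fintype.card_sum, Fintype.card_fin, Fintype.card_fin]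
    push_cast [Nat.cast_sub (Nat.one_le_iff_ne_zero.2 hpos.ne')]
    ring
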